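/- Let $F$ be a field, let $V$ be an $F$-vector space of countable (finite or countably infinite) dimension, and let $u$ be a locally finite endomorphism of $V$, i.e. for every $x \in V$ the family $(u^k(x))_{k \ge 0}$ is linearly dependent over $F$. Then the following conditions are equivalent: (i) $u$ is the sum of two square-zero endomorphisms of $V$, i.e. $u = a + b$ for some endomorphisms $a, b$ of $V$ with $a^2 = b^2 = 0$; (ii) $u$ has the exchange property, i.e. there are linear subspaces $V_1, V_2$ of $V$ such that $V = V_1 \oplus V_2$, $u(V_1) \subset V_2$ and $u(V_2) \subset V_1$. If in addition the characteristic of $F$ is not $2$, then these conditions are also equivalent to: (iii) $u$ is similar to $-u$, i.e. there is a linear automorphism $\varphi$ of $V$ such that $-u = \varphi \circ u \circ \varphi^{-1}$. -/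

import Mathlib

namespace TwoSquareZero

variable {F V W : Type*} [Field F] [AddCommGroup V] [Module F V] [AddCommGroup W] [Module F W]

/-- `u` is locally finite: for every vector `x`, the family `(u ^ k x)` indexed by the natural
numbers `k` is linearly dependent. -/
def IsLocallyFinite (u : Module.End F V) : Prop :=
  ∀ x : V, ¬ LinearIndependent F (fun k : ℕ => (u ^ k) x)

/-- `u` is the sum of two square-zero endomorphisms. -/
def IsSumOfTwoSquareZero (u : Module.End F V) : Prop :=
  ∃ a b : Module.End F V, a ^ 2 = 0 ∧ b ^ 2 = 0 ∧ u = a + b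

/-- `u` has the exchange property: the space is the direct sum of two linear subspaces
that `u` maps into one another. -/
def HasExchangeProperty (u : Module.End F V) : Prop :=
  ∃ V₁ V₂ : Submodule F V, IsCompl V₁ V₂ ∧ V₁.map u ≤ V₂ ∧ V₂.map u ≤ V₁

/-- `v` is similar to `u`: `v = φ ∘ u ∘ φ⁻¹` for some linear isomorphism `φ`. -/
def IsSimilar (u : Module.End F V) (v : Module.End F W) : Prop :=
  ∃ φ : V ≃ₗ[F] W, v = φ.toLinearMap ∘ₗ u ∘ₗ φ.symm.toLinearMap

end TwoSquareZero

/-!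
The vector space `V` is an `F[X]`-module through `u`, and the exchange property says exactly that this
module has a `ℤ/2`-grading for which `X` is odd. Such a grading gives a splitting of `u` into two
square-zero summands, and the automorphism equal to `1` on the even and `-1` on the odd part
conjugates `u` to `-u`. The content lies in the converse implications.

As `u` is locally finite, `V` is the direct sum of its primary parts
`V_q = {x | q(u²)ⁿ x = 0 for some n}`, for `q` monic irreducible
(`iSupIndep_primaryPart`, `iSup_primaryPart`). Each `V_q` is stable under every endomorphism that
commutes with `u²`; this includes both summands of a decomposition `u = a + b` with `a² = b² = 0`,
since `u² = ab + ba`, and every automorphism conjugating `u` to `-u`. So it suffices to find the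
grading on each `V_q` (`HasExchangeProperty.of_primaryPart_sq`).

* For `u = a + b` and `q ≠ X`, the restriction of `u` to `V_q` is bijective, and `V_q` is the direct
  sum of the kernels of `a` and `b`, which `u` exchanges
  (`HasExchangePropertyOn.of_sum_of_isCoprime`).
* For `φ u φ⁻¹ = -u` in characteristic other than `2`, pick an irreducible factor `g` of `q(X²)`;
  then `q(X²)` divides `g(X) g(-X)`. If `g(X)` and `g(-X)` are coprime, then `φ` exchanges the
  corresponding primary parts of `u`, and the vectors `x + φ x` and the vectors `x - φ x`, for `x` in
  the first part, form the required decomposition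
  (`HasExchangePropertyOn.of_isCoprime_comp_neg_X`).
* In the remaining cases `V_q` is `g`-primary for an irreducible polynomial `g` that is even or odd
  (`g = X` in the first situation), and a grading always exists, by countability
  (`exists_grading`).

The last point is proved in the manner of Ulm's theorem on countable primary groups. The grading is
built on an increasing sequence of finite-dimensional submodules `S`, and the construction can be
continued because the grading of `S` is required to respect the transfinite `g`-heights computed in
the whole module. The extension step (`IsGradedPair.extend`) adjoins a vector `z` with `g z ∈ S`,
after modifying `z` by a vector of `S` so as to have the largest possible height.
-/

namespace TwoSquareZero

open scoped Pointwise

/-! ### The transfinite height filtration -/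

section HeightFiltration

variable {R M : Type*} [CommRing R] [AddCommGroup M] [Module R M]

/-- The transfinite `p`-power filtration `M ⊇ p M ⊇ p² M ⊇ ⋯ ⊇ ⋂ pⁿ M ⊇ ⋯` of a module, encoded
without ordinals as the smallest family of submodules closed under `N ↦ p • N` and under
arbitrary intersections (the empty intersection provides `M` itself). -/
inductive IsHeightStage (p : R) : Submodule R M → Prop
  | smul {N : Submodule R M} : IsHeightStage p N → IsHeightStage p (p • N)
  | inf {𝒩 : Set (Submodule R M)} : (∀ N ∈ 𝒩, IsHeightStage p N) → IsHeightStage p (sInf 𝒩)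

variable {p : R} {N N' : Submodule R M}

theorem IsHeightStage.top : IsHeightStage p (⊤ : Submodule R M) := by
  have h : IsHeightStage p (sInf (∅ : Set (Submodule R M))) := .inf (by simp)
  rwa [sInf_empty] at h

theorem smul_le_self (p : R) (N : Submodule R M) : p • N ≤ N := by
  intro x hx
  obtain ⟨y, hy, rfl⟩ := (Submodule.mem_smul_pointwise_iff_exists _ _ _).1 hx
  exact N.smul_mem p hy

theorem smul_mono_stage (p : R) (h : N ≤ N') : p • N ≤ p • N' := by
  intro x hx
  obtain ⟨y, hy, rfl⟩ := (Submodule.mem_smul_pointwise_iff_exists _ _ _).1 hx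
  exact Submodule.smul_mem_pointwise_smul y p _ (h hy)

/-- One half of the comparison argument, as in the proof of the Bourbaki–Witt theorem. -/
theorem IsHeightStage.le_or_le_smul_of_forall
    (hN : ∀ N', IsHeightStage p N' → N < N' → N ≤ p • N') (hN' : IsHeightStage p N') :
    N ≤ N' ∨ N' ≤ p • N := by
  induction hN' with
  | @smul K hK ih =>
    rcases ih with h | h
    · rcases h.eq_or_lt with rfl | h
      · exact .inr le_rfl
      · exact .inl (hN _ hK h)
    · exact .inr (smul_mono_stage p (h.trans (smul_le_self p N)))
  | @inf 𝒩 h𝒩 ih =>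
    by_cases h : ∀ K ∈ 𝒩, N ≤ K
    · exact .inl (le_sInf h)
    · push Not at h
      obtain ⟨K, hK, hNK⟩ := h
      exact .inr ((sInf_le hK).trans ((ih K hK).resolve_left hNK))

theorem IsHeightStage.le_smul_of_lt (hN : IsHeightStage p N) :
    ∀ N', IsHeightStage p N' → N < N' → N ≤ p • N' := by
  induction hN with
  | @smul K hK ih =>
    intro N' hN' hlt
    rcases IsHeightStage.le_or_le_smul_of_forall ih hN' with h | h
    · exact smul_mono_stage p h
    · exact absurd h hlt.not_ge
  | @inf 𝒩 h𝒩 ih =>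
    intro N' hN' hlt
    obtain ⟨K, hK, hKN'⟩ : ∃ K ∈ 𝒩, ¬ N' ≤ K := by
      by_contra! h
      exact hlt.not_ge (le_sInf h)
    rcases IsHeightStage.le_or_le_smul_of_forall (ih K hK) hN' with h | h
    · exact (sInf_le hK).trans (ih K hK N' hN' (lt_of_le_not_ge h hKN'))
    · exact absurd (h.trans (smul_le_self p K)) hKN'

theorem IsHeightStage.le_of_smul_eq (hN : p • N = N) (hN' : IsHeightStage p N') : N ≤ N' := by
  induction hN' with
  | smul _ ih => exact hN.ge.trans (smul_mono_stage p ih)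
  | inf _ ih => exact le_sInf ih

/-- The filtration is a chain, and nothing lies strictly between `p • N` and `N`. -/
theorem IsHeightStage.le_or_lt (hN : IsHeightStage p N) (hN' : IsHeightStage p N') :
    N ≤ N' ∨ (N' ≤ p • N ∧ p • N < N) := by
  by_cases h : p • N = N
  · exact .inl (hN'.le_of_smul_eq h)
  · exact (IsHeightStage.le_or_le_smul_of_forall hN.le_smul_of_lt hN').imp_right
      fun h' => ⟨h', lt_of_le_of_ne (smul_le_self p N) h⟩

/-- Every vector has a height: a last stage of the filtration containing it. -/
theorem exists_least_stage (p : R) (x : M) :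
    ∃ N : Submodule R M, IsHeightStage p N ∧ x ∈ N ∧ ∀ N', IsHeightStage p N' → x ∈ N' → N ≤ N' :=
  ⟨sInf {N | IsHeightStage p N ∧ x ∈ N}, .inf fun _ h => h.1,
    by simp only [Submodule.mem_sInf]; exact fun _ h => h.2, fun _ h h' => sInf_le ⟨h, h'⟩⟩

end HeightFiltration

/-! ### Graded submodules respecting heights -/

/-- A grading of the commutative algebra `R` by `ℤ/2`, with even part `E` and odd part `O`. -/
structure IsParity {F R : Type*} [Field F] [CommRing R] [Algebra F R]
    (E O : Submodule F R) : Prop where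
  isCompl : IsCompl E O
  one_mem : (1 : R) ∈ E
  even_mul_even : ∀ {r s}, r ∈ E → s ∈ E → r * s ∈ E
  even_mul_odd : ∀ {r s}, r ∈ E → s ∈ O → r * s ∈ O
  odd_mul_odd : ∀ {r s}, r ∈ O → s ∈ O → r * s ∈ E

section Graded

variable {F R M : Type*} [Field F] [CommRing R] [Algebra F R] [AddCommGroup M] [Module F M]
  [Module R M] {E O : Submodule F R} {p : R} {A B : Submodule F M}

theorem IsParity.exists_add (hEO : IsParity E O) (r : R) : ∃ e ∈ E, ∃ o ∈ O, r = e + o := by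
  have h : r ∈ E ⊔ O := by rw [hEO.isCompl.sup_eq_top]; trivial
  obtain ⟨e, he, o, ho, h⟩ := Submodule.mem_sup.1 h
  exact ⟨e, he, o, ho, h.symm⟩

theorem IsParity.eq_and_eq (hEO : IsParity E O) {e e' o o' : R} (he : e ∈ E) (he' : e' ∈ E)
    (ho : o ∈ O) (ho' : o' ∈ O) (h : e + o = e' + o') : e = e' ∧ o = o' := by
  have h1 : e - e' = o' - o := by linear_combination h
  have h2 : e - e' = 0 := Submodule.disjoint_def.1 hEO.isCompl.disjoint _ (E.sub_mem he he')
    (h1 ▸ O.sub_mem ho' ho)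
  have h3 : e = e' := sub_eq_zero.1 h2
  exact ⟨h3, by rw [h3] at h; exact add_left_cancel h⟩

/-- The ideal generated by an even element is homogeneous. -/
theorem IsParity.dvd_of_even (hEO : IsParity E O) (hp : p ∈ E) {e o : R} (he : e ∈ E) (ho : o ∈ O)
    (h : p ∣ e + o) : ∃ d ∈ E, ∃ d' ∈ O, e = d * p ∧ o = d' * p := by
  obtain ⟨c, hc⟩ := h
  obtain ⟨d, hd, d', hd', rfl⟩ := hEO.exists_add c
  refine ⟨d, hd, d', hd', ?_⟩
  exact hEO.eq_and_eq he (hEO.even_mul_even hd hp) ho (mul_comm p d' ▸ hEO.even_mul_odd hp hd')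
    (by rw [hc]; ring)

/-- The ideal generated by an odd element is homogeneous. -/
theorem IsParity.dvd_of_odd (hEO : IsParity E O) (hp : p ∈ O) {e o : R} (he : e ∈ E) (ho : o ∈ O)
    (h : p ∣ e + o) : ∃ d ∈ O, ∃ d' ∈ E, e = d * p ∧ o = d' * p := by
  obtain ⟨c, hc⟩ := h
  obtain ⟨d, hd, d', hd', rfl⟩ := hEO.exists_add c
  refine ⟨d', hd', d, hd, ?_⟩
  exact hEO.eq_and_eq he (hEO.odd_mul_odd hd' hp) ho (hEO.even_mul_odd hd hp)
    (by rw [hc]; ring)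

/-- `A ⊕ B` is a finite-dimensional `R`-submodule of `M`, graded by `ℤ/2` with even part `A` and odd
part `B`, whose grading respects `p`-heights computed in `M`: the height of `a + b` is the smaller
one of the heights of `a` and `b`. -/
structure IsGradedPair (E O : Submodule F R) (p : R) (A B : Submodule F M) : Prop where
  even_smul_left : ∀ {r x}, r ∈ E → x ∈ A → r • x ∈ A
  even_smul_right : ∀ {r x}, r ∈ E → x ∈ B → r • x ∈ B
  odd_smul_left : ∀ {r x}, r ∈ O → x ∈ A → r • x ∈ B
  odd_smul_right : ∀ {r x}, r ∈ O → x ∈ B → r • x ∈ A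
  disjoint : Disjoint A B
  mem_left_of_add_mem : ∀ {N : Submodule R M} {a b : M}, IsHeightStage p N → a ∈ A → b ∈ B →
    a + b ∈ N → a ∈ N
  finite : FiniteDimensional F ↥(A ⊔ B)

namespace IsGradedPair

theorem mem_right_of_add_mem (h : IsGradedPair E O p A B) {N : Submodule R M} {a b : M}
    (hN : IsHeightStage p N) (ha : a ∈ A) (hb : b ∈ B) (hab : a + b ∈ N) : b ∈ N :=
  (N.add_mem_iff_right (h.mem_left_of_add_mem hN ha hb hab)).1 hab

theorem symm (h : IsGradedPair E O p A B) : IsGradedPair E O p B A where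
  even_smul_left := h.even_smul_right
  even_smul_right := h.even_smul_left
  odd_smul_left := h.odd_smul_right
  odd_smul_right := h.odd_smul_left
  disjoint := h.disjoint.symm
  mem_left_of_add_mem hN hb ha hba := h.mem_right_of_add_mem hN ha hb (by rwa [add_comm])
  finite := by rw [sup_comm]; exact h.finite

theorem smul_mem (hEO : IsParity E O) (h : IsGradedPair E O p A B) (r : R) {s : M}
    (hs : s ∈ A ⊔ B) : r • s ∈ A ⊔ B := by
  obtain ⟨a, ha, b, hb, rfl⟩ := Submodule.mem_sup.1 hs
  obtain ⟨e, he, o, ho, rfl⟩ := hEO.exists_add r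
  rw [Submodule.mem_sup]
  refine ⟨e • a + o • b, A.add_mem (h.even_smul_left he ha) (h.odd_smul_right ho hb),
    o • a + e • b, B.add_mem (h.odd_smul_left ho ha) (h.even_smul_right he hb), ?_⟩
  rw [add_smul, smul_add, smul_add]; abel

/-- Splitting a vector into its homogeneous components, named after the components in which
their multiples by the homogeneous element `p` lie. -/
theorem exists_split (h : IsGradedPair E O p A B) (hp : p ∈ E ∨ p ∈ O) {s : M}
    (hs : s ∈ A ⊔ B) : ∃ a ∈ A ⊔ B, ∃ b ∈ A ⊔ B, s = a + b ∧ p • a ∈ A ∧ p • b ∈ B ∧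
      ∀ N : Submodule R M, IsHeightStage p N → s ∈ N → a ∈ N ∧ b ∈ N := by
  obtain ⟨a, ha, b, hb, rfl⟩ := Submodule.mem_sup.1 hs
  have ha' : a ∈ A ⊔ B := Submodule.mem_sup_left ha
  have hb' : b ∈ A ⊔ B := Submodule.mem_sup_right hb
  rcases hp with hp | hp
  · exact ⟨a, ha', b, hb', rfl, h.even_smul_left hp ha, h.even_smul_right hp hb,
      fun N hN hab => ⟨h.mem_left_of_add_mem hN ha hb hab, h.mem_right_of_add_mem hN ha hb hab⟩⟩
  · exact ⟨b, hb', a, ha', add_comm _ _, h.odd_smul_right hp hb, h.odd_smul_left hp ha,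
      fun N hN hab => ⟨h.mem_right_of_add_mem hN ha hb hab, h.mem_left_of_add_mem hN ha hb hab⟩⟩

theorem bot (E O : Submodule F R) (p : R) : IsGradedPair E O p (⊥ : Submodule F M) ⊥ where
  even_smul_left := by simp
  even_smul_right := by simp
  odd_smul_left := by simp
  odd_smul_right := by simp
  disjoint := disjoint_bot_left
  mem_left_of_add_mem _ ha _ _ := by rw [(Submodule.mem_bot F).1 ha]; exact zero_mem _
  finite := by rw [sup_bot_eq]; infer_instance

/-- As `p` generates a maximal ideal (the hypothesis `hmax`), `A ⊕ B` meets `R x` only in `R p x`;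
as `p` and `p • x` are homogeneous, this intersection is graded. -/
theorem smul_mem_of_add_smul_mem (hEO : IsParity E O) (hmax : ∀ r, p ∣ r ∨ IsCoprime p r)
    (h : IsGradedPair E O p A B) {x : M} (hx : x ∉ A ⊔ B)
    (hpx : (p ∈ E ∧ p • x ∈ A) ∨ (p ∈ O ∧ p • x ∈ B)) {e o : R} (he : e ∈ E) (ho : o ∈ O)
    (hs : (e + o) • x ∈ A ⊔ B) : e • x ∈ A ∧ o • x ∈ B := by
  have hdvd : p ∣ e + o := by
    refine (hmax (e + o)).resolve_right fun ⟨c, d, hcd⟩ => hx ?_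
    have hpx' : p • x ∈ A ⊔ B :=
      hpx.elim (fun h => Submodule.mem_sup_left h.2) (fun h => Submodule.mem_sup_right h.2)
    have h1 := (A ⊔ B).add_mem (h.smul_mem hEO c hpx') (h.smul_mem hEO d hs)
    rwa [smul_smul, smul_smul, ← add_smul, hcd, one_smul] at h1
  rcases hpx with ⟨hp, hpx⟩ | ⟨hp, hpx⟩
  · obtain ⟨d, hd, d', hd', rfl, rfl⟩ := hEO.dvd_of_even hp he ho hdvd
    rw [mul_smul, mul_smul]
    exact ⟨h.even_smul_left hd hpx, h.odd_smul_left hd' hpx⟩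
  · obtain ⟨d, hd, d', hd', rfl, rfl⟩ := hEO.dvd_of_odd hp he ho hdvd
    rw [mul_smul, mul_smul]
    exact ⟨h.odd_smul_right hd hpx, h.even_smul_right hd' hpx⟩

end IsGradedPair

variable [IsScalarTower F R M]

/-- `x` lies in the stage `N` and no translate of `x` by a vector of `S` has larger height. -/
def IsProper (p : R) (S : Submodule F M) (N : Submodule R M) (x : M) : Prop :=
  x ∈ N ∧ (p • N < N → ∀ s ∈ S, x + s ∉ p • N)

/-- A selection principle: if every vector satisfying `Q` that is not proper with respect to the
finite-dimensional space `S` can be replaced by a vector of larger height satisfying `Q`, then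
some vector satisfying `Q` is proper. -/
theorem exists_isProper {S : Submodule F M} [FiniteDimensional F S] {N₀ : Submodule R M}
    (hN₀ : IsHeightStage p N₀) (Q : M → Prop) {x₀ : M} (hx₀ : x₀ ∈ N₀) (hQx₀ : Q x₀)
    (hQ : ∀ (N : Submodule R M) (x s : M), IsHeightStage p N → N ≤ N₀ → x ∈ N → Q x → s ∈ S →
      x + s ∈ p • N → ∃ x' ∈ p • N, Q x') :
    ∃ (N : Submodule R M) (x : M), IsHeightStage p N ∧ N ≤ N₀ ∧ Q x ∧ IsProper p S N x := by
  classical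
  -- Minimising the dimension of `S ∩ N` avoids a supremum of heights, which need not be attained.
  let d (N : Submodule R M) : ℕ := Module.finrank F ↥(S ⊓ N.restrictScalars F)
  have hex : ∃ n, ∃ N : Submodule R M, d N = n ∧ IsHeightStage p N ∧ N ≤ N₀ ∧ ∃ x ∈ N, Q x :=
    ⟨_, N₀, rfl, hN₀, le_rfl, x₀, hx₀, hQx₀⟩
  obtain ⟨N₁, hd, hN₁, hN₁₀, x, hx, hQx⟩ := Nat.find_spec hex
  have hmin : ∀ N : Submodule R M, IsHeightStage p N → N ≤ N₀ → (∃ x ∈ N, Q x) → d N₁ ≤ d N :=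
    fun N h1 h2 h3 => hd ▸ Nat.find_min' hex ⟨N, rfl, h1, h2, h3⟩
  obtain ⟨N, hN, hxN, hleast⟩ := exists_least_stage p x
  have hNN₁ : N ≤ N₁ := hleast _ hN₁ hx
  refine ⟨N, x, hN, hNN₁.trans hN₁₀, hQx, hxN, fun hlt s hs hxs => ?_⟩
  obtain ⟨x', hx', hQx'⟩ := hQ N x s hN (hNN₁.trans hN₁₀) hxN hQx hs hxs
  have hle : S ⊓ (p • N).restrictScalars F ≤ S ⊓ N₁.restrictScalars F :=
    inf_le_inf_left _ fun y hy => hNN₁ (smul_le_self p N hy)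
  have : FiniteDimensional F ↥(S ⊓ N₁.restrictScalars F) :=
    Submodule.finiteDimensional_of_le inf_le_left
  have heq := Submodule.eq_of_le_of_finrank_le hle
    (hmin _ hN.smul (hlt.le.trans (hNN₁.trans hN₁₀)) ⟨x', hx', hQx'⟩)
  have hsN : s ∈ N := (N.add_mem_iff_right hxN).1 (smul_le_self p N hxs)
  have hs' : s ∈ S ⊓ (p • N).restrictScalars F := heq ▸ ⟨hs, hNN₁ hsN⟩
  have hxp : x ∈ p • N := ((p • N).add_mem_iff_left hs'.2).1 hxs
  exact hlt.not_ge (hleast _ hN.smul hxp)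

/-! ### Extending a grading -/

/-- The `F`-linear map `r ↦ r • x`. -/
def orbitMap (F R : Type*) {M : Type*} [Field F] [CommRing R] [Algebra F R] [AddCommGroup M]
    [Module F M] [Module R M] [IsScalarTower F R M] (x : M) : R →ₗ[F] M :=
  (LinearMap.toSpanSingleton R M x).restrictScalars F

@[simp]
theorem orbitMap_apply (x : M) (r : R) : orbitMap F R x r = r • x := rfl

namespace IsGradedPair

/-- A proper vector `x` with `p • x` homogeneous can be adjoined to a graded pair; here the parity
is such that `x` becomes even. -/
theorem adjoin_even (hEO : IsParity E O) (hmax : ∀ r, p ∣ r ∨ IsCoprime p r)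
    (h : IsGradedPair E O p A B) {x : M} (hfin : FiniteDimensional F (orbitMap F R x).range)
    {N : Submodule R M} (hN : IsHeightStage p N) (hxN : IsProper p (A ⊔ B) N x) (hx : x ∉ A ⊔ B)
    (hpx : (p ∈ E ∧ p • x ∈ A) ∨ (p ∈ O ∧ p • x ∈ B)) :
    IsGradedPair E O p (A ⊔ E.map (orbitMap F R x)) (B ⊔ O.map (orbitMap F R x)) := by
  have hA : ∀ {y}, y ∈ A ⊔ E.map (orbitMap F R x) ↔ ∃ a ∈ A, ∃ e ∈ E, a + e • x = y := by
    simp [Submodule.mem_sup]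
  have hB : ∀ {y}, y ∈ B ⊔ O.map (orbitMap F R x) ↔ ∃ b ∈ B, ∃ o ∈ O, b + o • x = y := by
    simp [Submodule.mem_sup]
  have hpx' : p • x ∈ A ⊔ B :=
    hpx.elim (fun h => Submodule.mem_sup_left h.2) (fun h => Submodule.mem_sup_right h.2)
  refine ⟨?_, ?_, ?_, ?_, ?_, ?_, ?_⟩
  · intro r y hr hy
    obtain ⟨a, ha, e, he, rfl⟩ := hA.1 hy
    exact hA.2 ⟨r • a, h.even_smul_left hr ha, r * e, hEO.even_mul_even hr he, by
      rw [smul_add, mul_smul]⟩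
  · intro r y hr hy
    obtain ⟨a, ha, e, he, rfl⟩ := hB.1 hy
    exact hB.2 ⟨r • a, h.even_smul_right hr ha, r * e, hEO.even_mul_odd hr he, by
      rw [smul_add, mul_smul]⟩
  · intro r y hr hy
    obtain ⟨a, ha, e, he, rfl⟩ := hA.1 hy
    exact hB.2 ⟨r • a, h.odd_smul_left hr ha, r * e, mul_comm e r ▸ hEO.even_mul_odd he hr, by
      rw [smul_add, mul_smul]⟩
  · intro r y hr hy
    obtain ⟨a, ha, e, he, rfl⟩ := hB.1 hy
    exact hA.2 ⟨r • a, h.odd_smul_right hr ha, r * e, hEO.odd_mul_odd hr he, by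
      rw [smul_add, mul_smul]⟩
  · rw [Submodule.disjoint_def]
    intro y hyA hyB
    obtain ⟨a, ha, e, he, rfl⟩ := hA.1 hyA
    obtain ⟨b, hb, o, ho, hab⟩ := hB.1 hyB
    have hs : (e + -o) • x ∈ A ⊔ B := by
      have : (e + -o) • x = b - a := by
        rw [add_smul, neg_smul, eq_sub_iff_add_eq, ← add_sub_cancel_right b (o • x), hab]; abel
      rw [this]
      exact Submodule.sub_mem _ (Submodule.mem_sup_right hb) (Submodule.mem_sup_left ha)
    obtain ⟨h1, h2⟩ := h.smul_mem_of_add_smul_mem hEO hmax hx hpx he (O.neg_mem ho) hs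
    refine Submodule.disjoint_def.1 h.disjoint _ (A.add_mem ha h1) (hab ▸ B.add_mem hb ?_)
    rw [neg_smul] at h2
    exact neg_mem_iff.1 h2
  · intro N' y z hN' hy hz hyz
    obtain ⟨a, ha, e, he, rfl⟩ := hA.1 hy
    obtain ⟨b, hb, o, ho, rfl⟩ := hB.1 hz
    have hsum : a + e • x + (b + o • x) = (a + b) + (e + o) • x := by rw [add_smul]; abel
    have hab : a + b ∈ A ⊔ B := Submodule.add_mem_sup ha hb
    rcases hN.le_or_lt hN' with hle | ⟨hle, hlt⟩
    · have hxN' : x ∈ N' := hle hxN.1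
      rw [hsum, N'.add_mem_iff_left (N'.smul_mem _ hxN')] at hyz
      exact N'.add_mem (h.mem_left_of_add_mem hN' ha hb hyz) (N'.smul_mem _ hxN')
    · rcases hmax (e + o) with hdvd | ⟨c, d, hcd⟩
      · have hs : (e + o) • x ∈ A ⊔ B := by
          obtain ⟨c, hc⟩ := hdvd
          rw [hc, mul_comm, mul_smul]
          exact h.smul_mem hEO c hpx'
        obtain ⟨h1, h2⟩ := h.smul_mem_of_add_smul_mem hEO hmax hx hpx he ho hs
        exact h.mem_left_of_add_mem hN' (A.add_mem ha h1) (B.add_mem hb h2) hyz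
      · -- Otherwise `e + o` is invertible modulo `p`, and a translate of `x` has larger height.
        refine absurd (hle (N'.smul_mem d hyz)) ?_
        have : d • (a + e • x + (b + o • x)) = x + (d • (a + b) - c • p • x) := by
          have h1 : x = (c * p + d * (e + o)) • x := by rw [hcd, one_smul]
          rw [add_smul, mul_smul, mul_smul] at h1
          rw [hsum, smul_add]
          nth_rewrite 2 [h1]
          abel
        rw [this]
        exact hxN.2 hlt _ (Submodule.sub_mem _ (h.smul_mem hEO d hab) (h.smul_mem hEO c hpx'))
  · have := h.finite
    refine Submodule.finiteDimensional_of_le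
      (S₂ := (A ⊔ B) ⊔ (orbitMap F R x).range) (sup_le (sup_le ?_ ?_) (sup_le ?_ ?_))
    · exact le_sup_left.trans le_sup_left
    · exact LinearMap.map_le_range.trans le_sup_right
    · exact le_sup_right.trans le_sup_left
    · exact LinearMap.map_le_range.trans le_sup_right

/-- A proper vector `x` with `p • x ∈ A` can be adjoined to a graded pair: it becomes even or odd
according to the parity of `p`. -/
theorem adjoin (hEO : IsParity E O) (hmax : ∀ r, p ∣ r ∨ IsCoprime p r) (hp : p ∈ E ∨ p ∈ O)
    (h : IsGradedPair E O p A B) {x : M} (hfin : FiniteDimensional F (orbitMap F R x).range)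
    {N : Submodule R M} (hN : IsHeightStage p N) (hxN : IsProper p (A ⊔ B) N x) (hx : x ∉ A ⊔ B)
    (hpx : p • x ∈ A) :
    ∃ A' B' : Submodule F M, A ≤ A' ∧ B ≤ B' ∧ IsGradedPair E O p A' B' ∧ x ∈ A' ⊔ B' ∧
      ∀ t ∈ A' ⊔ B', ∃ s ∈ A ⊔ B, ∃ r : R, t = s + r • x := by
  have hmem : ∀ {y}, y ∈ E.map (orbitMap F R x) ⊔ O.map (orbitMap F R x) ↔ ∃ r : R, y = r • x := by
    intro y
    rw [← Submodule.map_sup, hEO.isCompl.sup_eq_top]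
    simp [eq_comm]
  have hspan : ∀ t ∈ A ⊔ B ⊔ (E.map (orbitMap F R x) ⊔ O.map (orbitMap F R x)),
      ∃ s ∈ A ⊔ B, ∃ r : R, t = s + r • x := by
    intro t ht
    obtain ⟨s, hs, y, hy, rfl⟩ := Submodule.mem_sup.1 ht
    obtain ⟨r, rfl⟩ := hmem.1 hy
    exact ⟨s, hs, r, rfl⟩
  have hx' : x ∈ A ⊔ B ⊔ (E.map (orbitMap F R x) ⊔ O.map (orbitMap F R x)) :=
    Submodule.mem_sup_right (hmem.2 ⟨1, (one_smul R x).symm⟩)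
  rcases hp with hp | hp
  · refine ⟨_, _, le_sup_left, le_sup_left,
      h.adjoin_even hEO hmax hfin hN hxN hx (.inl ⟨hp, hpx⟩), ?_, ?_⟩
    all_goals rwa [sup_sup_sup_comm]
  · refine ⟨_, _, le_sup_left, le_sup_left,
      (h.symm.adjoin_even hEO hmax hfin hN (sup_comm A B ▸ hxN) (sup_comm A B ▸ hx)
        (.inr ⟨hp, hpx⟩)).symm, ?_, ?_⟩
    all_goals rwa [sup_sup_sup_comm, sup_comm (O.map _)]

/-- A homogeneous vector `y` of `A` of the form `p • x` with `x` in the stage `N` acquires such an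
`x` in some larger graded pair, generated by `x` over the given one. The vector adjoined is a proper
`w` for which `p • w` is homogeneous and differs from `y` by `p • s` with `s` in `A ⊕ B`; then
`x = w - s`. -/
theorem lift (hEO : IsParity E O) (hmax : ∀ r, p ∣ r ∨ IsCoprime p r) (hp : p ∈ E ∨ p ∈ O)
    (hfin : ∀ x : M, FiniteDimensional F (orbitMap F R x).range)
    (h : IsGradedPair E O p A B) {N₀ : Submodule R M} (hN₀ : IsHeightStage p N₀) {y : M}
    (hy : y ∈ A) (hyN : y ∈ p • N₀) :
    ∃ A' B' : Submodule F M, A ≤ A' ∧ B ≤ B' ∧ IsGradedPair E O p A' B' ∧ ∃ x ∈ A' ⊔ B', x ∈ N₀ ∧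
      p • x = y ∧ ∀ t ∈ A' ⊔ B', ∃ s ∈ A ⊔ B, ∃ r : R, t = s + r • x := by
  obtain ⟨x₀, hx₀, rfl⟩ := (Submodule.mem_smul_pointwise_iff_exists _ _ _).1 hyN
  have := h.finite
  obtain ⟨N, x, hN, hNN₀, ⟨s, hs, hsN, hsA, hxs⟩, hxN⟩ := exists_isProper (S := A ⊔ B) hN₀
      (fun x => ∃ s ∈ A ⊔ B, s ∈ N₀ ∧ p • s ∈ A ∧ p • x = p • x₀ + p • s) hx₀
      ⟨0, zero_mem _, zero_mem _, by simp, by simp⟩ (by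
    rintro N x s' hN hNN₀ hxN ⟨s, hs, hsN, hsA, hxs⟩ hs' hxs'
    obtain ⟨a, ha, b, hb, rfl, hpa, hpb, hab⟩ := h.exists_split hp hs'
    have haN : a ∈ N := (hab N hN ((N.add_mem_iff_right hxN).1 (smul_le_self p N hxs'))).1
    -- If `x + s'` has larger height, so has the component `p • x + p • a` of `p • (x + s')`.
    have h1 : (p • x₀ + p • s + p • a) + p • b ∈ p • p • N := by
      have : p • (x + (a + b)) ∈ p • p • N := Submodule.smul_mem_pointwise_smul _ p _ hxs'
      rwa [smul_add, smul_add, hxs, ← add_assoc] at this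
    have h2 := h.mem_left_of_add_mem hN.smul.smul (A.add_mem (A.add_mem hy hsA) hpa) hpb h1
    obtain ⟨x', hx', hpx'⟩ := (Submodule.mem_smul_pointwise_iff_exists _ _ _).1 h2
    refine ⟨x', hx', s + a, add_mem hs ha, N₀.add_mem hsN (hNN₀ haN), ?_, ?_⟩
    · rw [smul_add]; exact A.add_mem hsA hpa
    · rw [hpx', smul_add, add_assoc])
  have hxN₀ : x - s ∈ N₀ := N₀.sub_mem (hNN₀ hxN.1) hsN
  have hpxs : p • (x - s) = p • x₀ := by rw [smul_sub, hxs]; abel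
  by_cases hx : x ∈ A ⊔ B
  · exact ⟨A, B, le_rfl, le_rfl, h, x - s, sub_mem hx hs, hxN₀, hpxs,
      fun t ht => ⟨t, ht, 0, by simp⟩⟩
  · obtain ⟨A', B', hA, hB, h', hxA', ht'⟩ := h.adjoin hEO hmax hp (hfin x) hN hxN hx
      (hxs ▸ A.add_mem hy hsA)
    refine ⟨A', B', hA, hB, h', x - s, sub_mem hxA' (sup_le_sup hA hB hs), hxN₀, hpxs, ?_⟩
    intro t ht
    obtain ⟨s', hs', r, rfl⟩ := ht' t ht
    exact ⟨s' + r • s, add_mem hs' (h.smul_mem hEO r hs), r, by rw [smul_sub]; abel⟩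

/-- The extension step: a vector `z` with `p • z` in a graded pair lies in some larger graded
pair. For `z` proper, write `p • z = y₀ + y₁` with homogeneous `y₀`, `y₁`. If `y₁` is, up to
corrections of larger height, a multiple of `y₀`, then a correction turns `p • z` into a unit
multiple of `y₀`. Otherwise `y₀` and `y₁` can be divided by `p` one after the other. -/
theorem extend (hEO : IsParity E O) (hmax : ∀ r, p ∣ r ∨ IsCoprime p r) (hp : p ∈ E ∨ p ∈ O)
    (hpu : ¬ IsUnit p) (hfin : ∀ x : M, FiniteDimensional F (orbitMap F R x).range)
    (htors : ∀ x : M, ∃ n : ℕ, p ^ n • x = 0)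
    (h : IsGradedPair E O p A B) {z : M} (hz : p • z ∈ A ⊔ B) :
    ∃ A' B' : Submodule F M, A ≤ A' ∧ B ≤ B' ∧ IsGradedPair E O p A' B' ∧ z ∈ A' ⊔ B' := by
  have := h.finite
  obtain ⟨N, z', hN, -, hzz', hz'⟩ := exists_isProper (S := A ⊔ B)
      (IsHeightStage.top (R := R) (M := M) (p := p))
      (fun x => x - z ∈ A ⊔ B) (Submodule.mem_top (x := z)) (by simp) (by
    intro N x s _ _ _ hxz hs hxs
    exact ⟨x + s, hxs, by rw [add_sub_right_comm]; exact add_mem hxz hs⟩)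
  have hpz' : p • z' ∈ A ⊔ B := by
    have := add_mem (h.smul_mem hEO p hzz') hz
    rwa [← smul_add, sub_add_cancel] at this
  -- It suffices to enlarge the graded pair by `z'`.
  have hdone : ∀ {A' B' : Submodule F M}, A ≤ A' → B ≤ B' → z' ∈ A' ⊔ B' → z ∈ A' ⊔ B' := by
    intro A' B' hA hB hmem
    have := sub_mem hmem (sup_le_sup hA hB hzz')
    rwa [sub_sub_cancel] at this
  obtain ⟨y₀, hy₀, y₁, hy₁, hy⟩ := Submodule.mem_sup.1 hpz'
  have hyN : y₀ + y₁ ∈ p • N := hy ▸ Submodule.smul_mem_pointwise_smul _ p _ hz'.1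
  have hy₀N := h.mem_left_of_add_mem hN.smul hy₀ hy₁ hyN
  by_cases hcase : ∃ s ∈ A ⊔ B, s ∈ N ∧ ∃ r : R, y₁ + r • y₀ + p • s ∈ p • p • N
  · obtain ⟨s, hs, hsN, r, hr⟩ := hcase
    obtain ⟨s₀, -, s₁, hs₁, rfl, hps₀, hps₁, hsplit⟩ := h.exists_split hp hs
    have hs₁N := (hsplit N hN hsN).2
    obtain ⟨e, he, o, ho, rfl⟩ := hEO.exists_add r
    have hv : y₁ + o • y₀ + p • s₁ ∈ p • p • N := by
      refine h.mem_right_of_add_mem hN.smul.smul (a := e • y₀ + p • s₀)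
        (A.add_mem (h.even_smul_left he hy₀) hps₀)
        (B.add_mem (B.add_mem hy₁ (h.odd_smul_left ho hy₀)) hps₁) ?_
      convert hr using 1
      rw [add_smul, smul_add]; abel
    -- Subtracting `x` from `z' + s₁` leaves a vector whose multiple by `p` is `(1 - o) • y₀`.
    obtain ⟨B', A', hB, hA, h', x, hx, hxN, hpx, hspan⟩ := h.symm.lift hEO hmax hp hfin hN.smul
      (B.add_mem (B.add_mem hy₁ (h.odd_smul_left ho hy₀)) hps₁) hv
    replace h' := h'.symm
    rw [sup_comm] at hx
    by_cases hz'A' : z' ∈ A' ⊔ B'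
    · exact ⟨A', B', hA, hB, h', hdone hA hB hz'A'⟩
    -- The ideal `(p)` is homogeneous, so that `p ∣ 1 - o` would imply `p ∣ 1`.
    have hunit : IsCoprime p (1 - o) := by
      refine (hmax _).resolve_left fun hdvd => hpu (isUnit_iff_dvd_one.2 ?_)
      rw [sub_eq_add_neg] at hdvd
      rcases hp with hp | hp
      · obtain ⟨d, -, d', -, h1, -⟩ := hEO.dvd_of_even hp hEO.one_mem (O.neg_mem ho) hdvd
        exact ⟨d, by rw [mul_comm]; exact h1⟩
      · obtain ⟨d, -, d', -, h1, -⟩ := hEO.dvd_of_odd hp hEO.one_mem (O.neg_mem ho) hdvd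
        exact ⟨d, by rw [mul_comm]; exact h1⟩
    -- Hence `c` inverts `1 - o` modulo a power of `p` that kills the vectors involved.
    obtain ⟨n₁, hn₁⟩ := htors (z' + s₁ - x)
    obtain ⟨n₂, hn₂⟩ := htors y₀
    obtain ⟨d, c, hdc⟩ := (hunit.pow_left (m := n₁ + n₂))
    have hpz₃ : p • (z' + s₁ - x) = (1 - o) • y₀ := by
      rw [smul_sub, smul_add, hpx, ← hy, sub_smul, one_smul]; abel
    have hinv : ∀ {w : M}, p ^ (n₁ + n₂) • w = 0 → (c * (1 - o)) • w = w := by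
      intro w hw
      have h1 : (d * p ^ (n₁ + n₂) + c * (1 - o)) • w = w := by rw [hdc, one_smul]
      rwa [add_smul, mul_smul, hw, smul_zero, zero_add] at h1
    have hz₃ : (1 - o) • c • (z' + s₁ - x) = z' + s₁ - x := by
      rw [smul_smul, mul_comm]
      exact hinv (by rw [add_comm, pow_add, mul_smul, hn₁, smul_zero])
    have hpw : p • c • (z' + s₁ - x) = y₀ := by
      rw [smul_comm, hpz₃, smul_smul]
      exact hinv (by rw [pow_add, mul_smul, hn₂, smul_zero])
    have hs₁' : s₁ ∈ A' ⊔ B' := sup_le_sup hA hB hs₁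
    have hback : ∀ {A'' B'' : Submodule F M}, A' ≤ A'' → B' ≤ B'' → IsGradedPair E O p A'' B'' →
        c • (z' + s₁ - x) ∈ A'' ⊔ B'' → z' ∈ A'' ⊔ B'' := by
      intro A'' B'' hA' hB' h'' hmem
      have h1 := h''.smul_mem hEO (1 - o) hmem
      rw [hz₃] at h1
      have h2 := sub_mem (add_mem h1 (sup_le_sup hA' hB' hx)) (sup_le_sup hA' hB' hs₁')
      rwa [sub_add_cancel, add_sub_cancel_right] at h2
    have hprop : IsProper p (A' ⊔ B') N (c • (z' + s₁ - x)) := by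
      refine ⟨N.smul_mem c (N.sub_mem (N.add_mem hz'.1 hs₁N) (smul_le_self p N hxN)), ?_⟩
      intro hlt t ht hmem
      obtain ⟨s', hs', r', hr'⟩ := hspan _ (sup_comm A' B' ▸ h'.smul_mem hEO (1 - o) ht)
      have h1 := (p • N).smul_mem (1 - o) hmem
      rw [smul_add, hz₃, hr'] at h1
      refine hz'.2 hlt (s₁ + s') (add_mem hs₁ (sup_comm A B ▸ hs')) ?_
      have h2 := (p • N).add_mem h1 ((p • N).sub_mem hxN ((p • N).smul_mem r' hxN))
      convert h2 using 1
      abel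
    obtain ⟨A'', B'', hA', hB', h'', hmem, -⟩ := h'.adjoin hEO hmax hp (hfin _) hN hprop
      (fun hmem => hz'A' (hback le_rfl le_rfl h' hmem)) (hpw ▸ hA hy₀)
    exact ⟨A'', B'', hA.trans hA', hB.trans hB', h'',
      hdone (hA.trans hA') (hB.trans hB') (hback hA' hB' h'' hmem)⟩
  · -- Adjoin `x` with `p • x = y₀`; then `z' - x` stays proper, and `p • (z' - x) = y₁`.
    obtain ⟨A', B', hA, hB, h', x, hx, hxN, hpx, hspan⟩ := h.lift hEO hmax hp hfin hN hy₀ hy₀N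
    by_cases hz'A' : z' - x ∈ A' ⊔ B'
    · exact ⟨A', B', hA, hB, h', hdone hA hB (by simpa using add_mem hz'A' hx)⟩
    have hpz₁ : p • (z' - x) = y₁ := by rw [smul_sub, hpx, ← hy]; abel
    have hprop : IsProper p (B' ⊔ A') N (z' - x) := by
      refine ⟨N.sub_mem hz'.1 hxN, fun hlt t ht hmem => hcase ?_⟩
      obtain ⟨s, hs, r, rfl⟩ := hspan t (sup_comm A' B' ▸ ht)
      refine ⟨s, hs, ?_, r, ?_⟩
      · have h1 := N.sub_mem (smul_le_self p N hmem)
          (N.add_mem (N.sub_mem hz'.1 hxN) (N.smul_mem r hxN))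
        convert h1 using 1
        abel
      · have h1 : p • (z' - x + (s + r • x)) ∈ p • p • N :=
          Submodule.smul_mem_pointwise_smul _ p _ hmem
        convert h1 using 1
        rw [smul_add, hpz₁, smul_add, smul_comm p r, hpx]; abel
    obtain ⟨B'', A'', hB', hA', h'', hmem, -⟩ := h'.symm.adjoin hEO hmax hp (hfin _) hN hprop
      (by rwa [sup_comm]) (hpz₁ ▸ hB hy₁)
    rw [sup_comm] at hmem
    exact ⟨A'', B'', hA.trans hA', hB.trans hB', h''.symm, hdone (hA.trans hA') (hB.trans hB')
      (by simpa using add_mem hmem (sup_le_sup hA' hB' hx))⟩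

theorem exists_extension (hEO : IsParity E O) (hmax : ∀ r, p ∣ r ∨ IsCoprime p r)
    (hp : p ∈ E ∨ p ∈ O) (hpu : ¬ IsUnit p)
    (hfin : ∀ x : M, FiniteDimensional F (orbitMap F R x).range)
    (htors : ∀ x : M, ∃ n : ℕ, p ^ n • x = 0) (h : IsGradedPair E O p A B) (z : M) :
    ∃ A' B' : Submodule F M, A ≤ A' ∧ B ≤ B' ∧ IsGradedPair E O p A' B' ∧ z ∈ A' ⊔ B' := by
  obtain ⟨n, hn⟩ := htors z
  induction n generalizing z with
  | zero => exact ⟨A, B, le_rfl, le_rfl, h, by simp_all⟩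
  | succ n ih =>
    obtain ⟨A', B', hA, hB, h', hz⟩ := ih (p • z) (by rwa [smul_smul, ← pow_succ])
    obtain ⟨A'', B'', hA', hB', h'', hz'⟩ := h'.extend hEO hmax hp hpu hfin htors hz
    exact ⟨A'', B'', hA.trans hA', hB.trans hB', h'', hz'⟩

end IsGradedPair

/-- A countable-dimensional torsion module that is primary for a homogeneous prime element `p`
carries a `ℤ/2`-grading compatible with that of `R`. -/
theorem exists_grading (hEO : IsParity E O) (hmax : ∀ r, p ∣ r ∨ IsCoprime p r)
    (hp : p ∈ E ∨ p ∈ O) (hpu : ¬ IsUnit p)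
    (hfin : ∀ x : M, FiniteDimensional F (orbitMap F R x).range)
    (htors : ∀ x : M, ∃ n : ℕ, p ^ n • x = 0) {z : ℕ → M}
    (hz : Submodule.span F (Set.range z) = ⊤) :
    ∃ A B : Submodule F M, IsCompl A B ∧ (∀ o ∈ O, ∀ x ∈ A, o • x ∈ B) ∧
      ∀ o ∈ O, ∀ x ∈ B, o • x ∈ A := by
  have hext := fun (P : {P : Submodule F M × Submodule F M // IsGradedPair E O p P.1 P.2}) (n : ℕ) =>
    P.2.exists_extension hEO hmax hp hpu hfin htors (z n)
  choose A' B' hA hB h hmem using hext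
  let P : ℕ → {P : Submodule F M × Submodule F M // IsGradedPair E O p P.1 P.2} := fun n =>
    Nat.rec ⟨(⊥, ⊥), IsGradedPair.bot E O p⟩ (fun n Q => ⟨(A' Q n, B' Q n), h Q n⟩) n
  have hmonoA : Monotone fun n => (P n).1.1 := monotone_nat_of_le_succ fun n => hA (P n) n
  have hmonoB : Monotone fun n => (P n).1.2 := monotone_nat_of_le_succ fun n => hB (P n) n
  have hmemA : ∀ {x}, x ∈ ⨆ n, (P n).1.1 ↔ ∃ n, x ∈ (P n).1.1 :=
    Submodule.mem_iSup_of_directed _ hmonoA.directed_le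
  have hmemB : ∀ {x}, x ∈ ⨆ n, (P n).1.2 ↔ ∃ n, x ∈ (P n).1.2 :=
    Submodule.mem_iSup_of_directed _ hmonoB.directed_le
  refine ⟨⨆ n, (P n).1.1, ⨆ n, (P n).1.2, ⟨?_, ?_⟩, ?_, ?_⟩
  · rw [Submodule.disjoint_def]
    intro x hx hx'
    obtain ⟨n, hn⟩ := hmemA.1 hx
    obtain ⟨m, hm⟩ := hmemB.1 hx'
    exact Submodule.disjoint_def.1 (P (max n m)).2.disjoint x (hmonoA (le_max_left n m) hn)
      (hmonoB (le_max_right n m) hm)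
  · rw [codisjoint_iff, eq_top_iff, ← hz, Submodule.span_le]
    rintro _ ⟨n, rfl⟩
    exact sup_le_sup (le_iSup (fun n => (P n).1.1) (n + 1)) (le_iSup (fun n => (P n).1.2) (n + 1))
      (hmem (P n) n)
  · intro o ho x hx
    obtain ⟨n, hn⟩ := hmemA.1 hx
    exact hmemB.2 ⟨n, (P n).2.odd_smul_left ho hn⟩
  · intro o ho x hx
    obtain ⟨n, hn⟩ := hmemB.1 hx
    exact hmemA.2 ⟨n, (P n).2.odd_smul_right ho hn⟩

end Graded

/-! ### Even and odd polynomials -/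

open Polynomial

variable {F V : Type*} [Field F] [AddCommGroup V] [Module F V]

/-- The polynomials `h(X²)`. -/
def evenPolynomials (F : Type*) [Field F] : Submodule F F[X] where
  carrier := {f | ∀ n, Odd n → f.coeff n = 0}
  add_mem' hf hg n hn := by rw [coeff_add, hf n hn, hg n hn, add_zero]
  zero_mem' n _ := coeff_zero n
  smul_mem' c f hf n hn := by rw [coeff_smul, hf n hn, smul_zero]

/-- The polynomials `X h(X²)`. -/
def oddPolynomials (F : Type*) [Field F] : Submodule F F[X] where
  carrier := {f | ∀ n, Even n → f.coeff n = 0}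
  add_mem' hf hg n hn := by rw [coeff_add, hf n hn, hg n hn, add_zero]
  zero_mem' n _ := coeff_zero n
  smul_mem' c f hf n hn := by rw [coeff_smul, hf n hn, smul_zero]

theorem X_mem_oddPolynomials : (X : F[X]) ∈ oddPolynomials F := by
  intro n hn
  rw [coeff_X, if_neg]
  rintro rfl
  exact absurd hn (by decide)

theorem isParity_polynomials (F : Type*) [Field F] :
    IsParity (evenPolynomials F) (oddPolynomials F) where
  isCompl := by
    constructor
    · rw [Submodule.disjoint_def]
      intro f hf hf'
      ext n
      exact (Nat.even_or_odd n).elim (hf' n) (hf n)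
    · rw [codisjoint_iff, eq_top_iff]
      rintro f -
      induction f using Polynomial.induction_on' with
      | add f g hf hg => exact add_mem hf hg
      | monomial n a =>
        rcases Nat.even_or_odd n with hn | hn
        · refine Submodule.mem_sup_left fun m hm => ?_
          rw [coeff_monomial, if_neg]
          rintro rfl
          exact Nat.not_even_iff_odd.2 hm hn
        · refine Submodule.mem_sup_right fun m hm => ?_
          rw [coeff_monomial, if_neg]
          rintro rfl
          exact Nat.not_even_iff_odd.2 hn hm
  one_mem n hn := by
    rw [coeff_one, if_neg]
    rintro rfl
    exact absurd hn (by decide)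
  even_mul_even {f g} hf hg n hn := by
    rw [coeff_mul]
    refine Finset.sum_eq_zero fun ij hij => ?_
    rw [← Finset.HasAntidiagonal.mem_antidiagonal.1 hij, Nat.odd_add] at hn
    rcases Nat.even_or_odd ij.1 with h | h
    · rw [hg _ (by rw [← Nat.not_even_iff_odd] at *; tauto), mul_zero]
    · rw [hf _ h, zero_mul]
  even_mul_odd {f g} hf hg n hn := by
    rw [coeff_mul]
    refine Finset.sum_eq_zero fun ij hij => ?_
    rw [← Finset.HasAntidiagonal.mem_antidiagonal.1 hij, Nat.even_add] at hn
    rcases Nat.even_or_odd ij.1 with h | h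
    · rw [hg _ (hn.1 h), mul_zero]
    · rw [hf _ h, zero_mul]
  odd_mul_odd {f g} hf hg n hn := by
    rw [coeff_mul]
    refine Finset.sum_eq_zero fun ij hij => ?_
    rw [← Finset.HasAntidiagonal.mem_antidiagonal.1 hij, Nat.odd_add] at hn
    rcases Nat.even_or_odd ij.1 with h | h
    · rw [hf _ h, zero_mul]
    · rw [hg _ (hn.1 h), mul_zero]

theorem exists_span_range_eq_top (hV : Module.rank F V ≤ Cardinal.aleph0) :
    ∃ z : ℕ → V, Submodule.span F (Set.range z) = ⊤ := by
  let b := Module.Basis.ofVectorSpace F V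
  have hcount : Countable (Module.Basis.ofVectorSpaceIndex F V) := by
    rw [← Cardinal.mk_le_aleph0_iff, b.mk_eq_rank'']
    exact hV
  obtain ⟨f, hf⟩ := exists_surjective_nat (Option (Module.Basis.ofVectorSpaceIndex F V))
  refine ⟨fun n => (f n).elim 0 b, eq_top_iff.2 ?_⟩
  rw [← b.span_eq]
  refine Submodule.span_mono ?_
  rintro _ ⟨i, rfl⟩
  obtain ⟨n, hn⟩ := hf (some i)
  exact ⟨n, by simp [hn]⟩

/-- The graded decomposition of a primary module over `F[X]`, in terms of endomorphisms. -/
theorem hasExchangeProperty_of_primary (hV : Module.rank F V ≤ Cardinal.aleph0)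
    (u : Module.End F V) {g : F[X]} (hg : Irreducible g)
    (hpar : g ∈ evenPolynomials F ∨ g ∈ oddPolynomials F)
    (htors : ∀ x, ∃ n : ℕ, aeval u (g ^ n) x = 0) : HasExchangeProperty u := by
  obtain ⟨z, hz⟩ := exists_span_range_eq_top hV
  let ε : V ≃ₗ[F] Module.AEval' u := Module.AEval'.of u
  have hε : ∀ (f : F[X]) (x : V), f • ε x = ε (aeval u f x) := fun _ _ => rfl
  have htors' : ∀ x : Module.AEval' u, ∃ n : ℕ, g ^ n • x = 0 := by
    intro x
    obtain ⟨x, rfl⟩ := ε.surjective x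
    obtain ⟨n, hn⟩ := htors x
    exact ⟨n, by rw [hε, hn, map_zero]⟩
  have hfin : ∀ x : Module.AEval' u, FiniteDimensional F (orbitMap F F[X] x).range := by
    intro x
    obtain ⟨n, hn⟩ := htors' x
    have : FiniteDimensional F (degreeLT F (g ^ n).natDegree) :=
      Module.Finite.equiv (degreeLTEquiv F _).symm
    refine Submodule.finiteDimensional_of_le
      (S₂ := (degreeLT F (g ^ n).natDegree).map (orbitMap F F[X] x)) ?_
    rintro _ ⟨r, rfl⟩
    have hg0 : g ^ n ≠ 0 := pow_ne_zero n hg.ne_zero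
    refine ⟨r % g ^ n, ?_, ?_⟩
    · rw [SetLike.mem_coe, mem_degreeLT, ← degree_eq_natDegree hg0]
      exact degree_mod_lt r hg0
    · rw [orbitMap_apply, orbitMap_apply]
      nth_rewrite 2 [← EuclideanDomain.mod_add_div r (g ^ n)]
      rw [add_smul, mul_comm, mul_smul, hn, smul_zero, add_zero]
  have hz' : Submodule.span F (Set.range (ε ∘ z)) = ⊤ := by
    rw [Set.range_comp, ← LinearEquiv.coe_coe, Submodule.span_image, hz, Submodule.map_top,
      LinearEquiv.range]
  obtain ⟨A, B, hAB, hA, hB⟩ := exists_grading (isParity_polynomials F)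
    (fun r => or_iff_not_imp_left.2 hg.coprime_iff_not_dvd.2) hpar hg.not_isUnit hfin htors' hz'
  refine ⟨A.comap ε.toLinearMap, B.comap ε.toLinearMap, ?_, ?_, ?_⟩
  · exact (Submodule.orderIsoMapComap ε).symm.isCompl hAB
  · rintro _ ⟨x, hx, rfl⟩
    have : X • ε x ∈ B := hA X X_mem_oddPolynomials _ hx
    rwa [hε, aeval_X] at this
  · rintro _ ⟨x, hx, rfl⟩
    have : X • ε x ∈ A := hB X X_mem_oddPolynomials _ hx
    rwa [hε, aeval_X] at this

/-! ### Primary decomposition -/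

/-- The `q`-primary part of `V` for the `F[X]`-module structure given by the endomorphism `w`. -/
def primaryPart (w : Module.End F V) (q : F[X]) : Submodule F V where
  carrier := {x | ∃ n : ℕ, aeval w (q ^ n) x = 0}
  zero_mem' := ⟨0, map_zero _⟩
  add_mem' := by
    rintro x y ⟨n, hn⟩ ⟨m, hm⟩
    refine ⟨n + m, ?_⟩
    rw [map_add]
    nth_rewrite 1 [add_comm n m]
    rw [pow_add, pow_add, aeval_mul, aeval_mul, Module.End.mul_apply, Module.End.mul_apply, hn, hm,
      map_zero, map_zero, add_zero]
  smul_mem' := by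
    rintro c x ⟨n, hn⟩
    exact ⟨n, by rw [map_smul, hn, smul_zero]⟩

theorem mem_primaryPart {w : Module.End F V} {q : F[X]} {x : V} :
    x ∈ primaryPart w q ↔ ∃ n : ℕ, aeval w (q ^ n) x = 0 :=
  Iff.rfl

theorem aeval_apply_eq_zero_of_dvd {w : Module.End F V} {f g : F[X]} (h : f ∣ g) {x : V}
    (hx : aeval w f x = 0) : aeval w g x = 0 := by
  obtain ⟨c, rfl⟩ := h
  rw [mul_comm, aeval_mul, Module.End.mul_apply, hx, map_zero]

theorem primaryPart_mono {w : Module.End F V} {f g : F[X]} (h : f ∣ g) :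
    primaryPart w f ≤ primaryPart w g :=
  fun _ ⟨n, hn⟩ => ⟨n, aeval_apply_eq_zero_of_dvd (pow_dvd_pow_of_dvd h n) hn⟩

theorem eq_zero_of_isCoprime {w : Module.End F V} {f g : F[X]} (h : IsCoprime f g) {x : V}
    (hf : aeval w f x = 0) (hg : aeval w g x = 0) : x = 0 := by
  obtain ⟨a, b, hab⟩ := h
  have h1 := aeval_apply_eq_zero_of_dvd (dvd_mul_left f a) hf
  have h2 := aeval_apply_eq_zero_of_dvd (dvd_mul_left g b) hg
  have h3 : aeval w (a * f + b * g) x = 0 := by rw [aeval_add, LinearMap.add_apply, h1, h2, add_zero]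
  rwa [hab, aeval_one] at h3

/-- A vector killed by a product of coprime polynomials is a sum of vectors killed by the
factors. -/
theorem exists_add_of_isCoprime {w : Module.End F V} {f g : F[X]} (h : IsCoprime f g) {x : V}
    (hx : aeval w (f * g) x = 0) : ∃ y z, aeval w f y = 0 ∧ aeval w g z = 0 ∧ x = y + z := by
  obtain ⟨a, b, hab⟩ := h
  refine ⟨aeval w (b * g) x, aeval w (a * f) x, ?_, ?_, ?_⟩
  · rw [← Module.End.mul_apply, ← aeval_mul]
    exact aeval_apply_eq_zero_of_dvd ⟨b, by ring⟩ hx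
  · rw [← Module.End.mul_apply, ← aeval_mul]
    exact aeval_apply_eq_zero_of_dvd ⟨a, by ring⟩ hx
  · rw [← LinearMap.add_apply, ← aeval_add, add_comm, hab, aeval_one, Module.End.one_apply]

theorem commute_aeval {w c : Module.End F V} (h : Commute w c) (f : F[X]) :
    Commute (aeval w f) c := by
  induction f using Polynomial.induction_on' with
  | add f g hf hg => rw [aeval_add]; exact hf.add_left hg
  | monomial n a =>
    rw [aeval_monomial]
    exact (Algebra.commute_algebraMap_left _ _).mul_left (h.pow_left n)

theorem apply_mem_primaryPart {w c : Module.End F V} (h : Commute w c) {q : F[X]} {x : V}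
    (hx : x ∈ primaryPart w q) : c x ∈ primaryPart w q := by
  obtain ⟨n, hn⟩ := hx
  refine ⟨n, ?_⟩
  have h1 : Commute (aeval w (q ^ n)) c := commute_aeval h _
  rw [← Module.End.mul_apply, h1.eq, Module.End.mul_apply, hn, map_zero]

theorem iSupIndep_primaryPart (w : Module.End F V) :
    iSupIndep fun q : {q : F[X] // Irreducible q ∧ q.Monic} => primaryPart w q.1 := by
  intro q
  have hq : Prime q.1 := q.2.1.prime
  -- The vectors killed by some polynomial prime to `q`.
  let K : Submodule F V :=
    { carrier := {x | ∃ f : F[X], ¬ q.1 ∣ f ∧ aeval w f x = 0}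
      zero_mem' := ⟨1, fun h => hq.not_isUnit (isUnit_of_dvd_one h), map_zero _⟩
      add_mem' := by
        rintro x y ⟨f, hf, hx⟩ ⟨g, hg, hy⟩
        refine ⟨f * g, fun h => (hq.dvd_or_dvd h).elim hf hg, ?_⟩
        rw [map_add, aeval_apply_eq_zero_of_dvd (dvd_mul_right f g) hx,
          aeval_apply_eq_zero_of_dvd (dvd_mul_left g f) hy, add_zero]
      smul_mem' := by
        rintro c x ⟨f, hf, hx⟩
        exact ⟨f, hf, by rw [map_smul, hx, smul_zero]⟩ }
  have hK : (⨆ (r) (_ : r ≠ q), primaryPart w r.1) ≤ K := by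
    refine iSup₂_le fun r hr x ⟨n, hn⟩ => ⟨r.1 ^ n, fun h => hr ?_, hn⟩
    have := (q.2.1.associated_of_dvd r.2.1 (hq.dvd_of_dvd_pow h))
    exact Subtype.ext (eq_of_monic_of_associated q.2.2 r.2.2 this).symm
  refine Disjoint.mono_right hK ?_
  rw [Submodule.disjoint_def]
  rintro x ⟨n, hn⟩ ⟨f, hf, hx⟩
  exact eq_zero_of_isCoprime ((q.2.1.coprime_iff_not_dvd.2 hf).pow_left) hn hx

theorem iSup_primaryPart {w : Module.End F V} (hw : ∀ x, ∃ f : F[X], f ≠ 0 ∧ aeval w f x = 0) :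
    ⨆ q : {q : F[X] // Irreducible q ∧ q.Monic}, primaryPart w q.1 = ⊤ := by
  classical
  rw [eq_top_iff]
  rintro x -
  obtain ⟨f, hf, hx⟩ := hw x
  induction f using UniqueFactorizationMonoid.induction_on_coprime generalizing x with
  | h0 => exact absurd rfl hf
  | h1 h =>
    have hx1 := aeval_apply_eq_zero_of_dvd (isUnit_iff_dvd_one.1 h) hx
    rw [aeval_one, Module.End.one_apply] at hx1
    rw [hx1]
    exact zero_mem _
  | @hpr p n hp =>
    refine Submodule.mem_iSup_of_mem
      ⟨normalize p, (normalize_associated p).irreducible_iff.2 hp.irreducible,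
        monic_normalize hp.ne_zero⟩ ?_
    exact ⟨n, aeval_apply_eq_zero_of_dvd (pow_dvd_pow_of_dvd (dvd_normalize_iff.2 dvd_rfl) n) hx⟩
  | hcp h h1 h2 =>
    obtain ⟨y, z, hy, hz, rfl⟩ := exists_add_of_isCoprime h.isCoprime hx
    exact add_mem (h1 (left_ne_zero_of_mul hf) hy) (h2 (right_ne_zero_of_mul hf) hz)

/-- The exchange property for the endomorphism that `u` induces on an invariant subspace `W`,
in terms of subspaces of the ambient space. -/
def HasExchangePropertyOn (u : Module.End F V) (W : Submodule F V) : Prop :=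
  ∃ A B : Submodule F V, Disjoint A B ∧ A ⊔ B = W ∧ A.map u ≤ B ∧ B.map u ≤ A

theorem HasExchangePropertyOn.of_restrict {u : Module.End F V} {W : Submodule F V}
    (hW : ∀ x ∈ W, u x ∈ W) (h : HasExchangeProperty (u.restrict hW)) :
    HasExchangePropertyOn u W := by
  obtain ⟨A, B, hAB, hA, hB⟩ := h
  refine ⟨A.map W.subtype, B.map W.subtype, ?_, ?_, ?_, ?_⟩
  · exact Submodule.disjoint_map W.subtype_injective hAB.disjoint
  · rw [← Submodule.map_sup, hAB.sup_eq_top, Submodule.map_top, Submodule.range_subtype]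
  · rintro _ ⟨_, ⟨x, hx, rfl⟩, rfl⟩
    exact ⟨_, hA ⟨x, hx, rfl⟩, rfl⟩
  · rintro _ ⟨_, ⟨x, hx, rfl⟩, rfl⟩
    exact ⟨_, hB ⟨x, hx, rfl⟩, rfl⟩

theorem HasExchangeProperty.of_iSupIndep {ι : Type*} {u : Module.End F V} {W : ι → Submodule F V}
    (hind : iSupIndep W) (htop : ⨆ i, W i = ⊤) (h : ∀ i, HasExchangePropertyOn u (W i)) :
    HasExchangeProperty u := by
  classical
  choose A B hAB hsup hA hB using h
  have hAW : ∀ i, A i ≤ W i := fun i => hsup i ▸ le_sup_left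
  have hBW : ∀ i, B i ≤ W i := fun i => hsup i ▸ le_sup_right
  refine ⟨⨆ i, A i, ⨆ i, B i, ⟨?_, ?_⟩, ?_, ?_⟩
  · rw [Submodule.disjoint_def]
    intro x hxA hxB
    obtain ⟨a, ha, rfl⟩ := (Submodule.mem_iSup_iff_exists_finsupp _ _).1 hxA
    obtain ⟨b, hb, hab⟩ := (Submodule.mem_iSup_iff_exists_finsupp _ _).1 hxB
    rw [Finsupp.sum_of_support_subset a Finset.subset_union_left _ (by simp),
      Finsupp.sum_of_support_subset b Finset.subset_union_right _ (by simp)] at hab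
    have heq := (iSupIndep_iff_finsetSum_eq_imp_eq W).1 hind (a.support ∪ b.support) a b
      (fun i _ => ⟨hAW i (ha i), hBW i (hb i)⟩) hab.symm
    refine Finset.sum_eq_zero fun i hi => Submodule.disjoint_def.1 (hAB i) _ (ha i) ?_
    rw [heq i (Finset.mem_union_left _ hi)]
    exact hb i
  · rw [codisjoint_iff, ← iSup_sup_eq, ← htop]
    exact iSup_congr hsup
  · rw [Submodule.map_iSup]
    exact iSup_mono hA
  · rw [Submodule.map_iSup]
    exact iSup_mono hB

theorem aeval_restrict_apply {u : Module.End F V} {W : Submodule F V} (hW : ∀ x ∈ W, u x ∈ W)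
    (f : F[X]) (x : W) : (aeval (u.restrict hW) f x : V) = aeval u f x := by
  induction f using Polynomial.induction_on' generalizing x with
  | add f g hf hg => simp [hf, hg]
  | monomial n a =>
    rw [aeval_monomial, aeval_monomial, Module.End.pow_restrict n]
    rfl

theorem HasExchangePropertyOn.of_primary (hV : Module.rank F V ≤ Cardinal.aleph0)
    {u : Module.End F V} {W : Submodule F V} (hW : ∀ x ∈ W, u x ∈ W) {g : F[X]}
    (hg : Irreducible g) (hpar : g ∈ evenPolynomials F ∨ g ∈ oddPolynomials F)
    (hWg : W ≤ primaryPart u g) : HasExchangePropertyOn u W := by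
  refine .of_restrict hW (hasExchangeProperty_of_primary ((Submodule.rank_le W).trans hV) _ hg hpar
    fun x => ?_)
  obtain ⟨n, hn⟩ := hWg x.2
  exact ⟨n, Subtype.ext (by rw [aeval_restrict_apply, hn]; rfl)⟩

theorem IsLocallyFinite.exists_aeval_eq_zero {u : Module.End F V} (hu : IsLocallyFinite u) (x : V) :
    ∃ f : F[X], f ≠ 0 ∧ aeval u f x = 0 := by
  by_contra! h
  refine hu x ?_
  let L : F[X] →ₗ[F] V := (LinearMap.applyₗ x).comp (aeval u).toLinearMap
  have hL : LinearMap.ker L = ⊥ := LinearMap.ker_eq_bot'.2 fun f hf => by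
    by_contra hf0
    exact h f hf0 hf
  have hLu : (fun k : ℕ => (u ^ k) x) = L ∘ basisMonomials F := by
    funext k
    simp [L, aeval_monomial]
  rw [hLu]
  exact (basisMonomials F).linearIndependent.map' L hL

/-- Every nonzero polynomial divides a nonzero polynomial in `X²`. -/
theorem exists_dvd_expand {f : F[X]} (hf : f ≠ 0) : ∃ h : F[X], h ≠ 0 ∧ f ∣ expand F 2 h := by
  have : FiniteDimensional F (AdjoinRoot f) := (AdjoinRoot.powerBasis hf).finite
  obtain ⟨h, hh, h0⟩ := Algebra.IsAlgebraic.isAlgebraic (R := F) (AdjoinRoot.root f ^ 2)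
  refine ⟨h, hh, ?_⟩
  rw [← AdjoinRoot.mk_eq_zero, ← AdjoinRoot.aeval_eq, expand_aeval, h0]

/-- The decomposition of `V` into the primary parts of `u ^ 2`: it is preserved by all the
endomorphisms that commute with `u ^ 2`. -/
theorem HasExchangeProperty.of_primaryPart_sq {u : Module.End F V} (hu : IsLocallyFinite u)
    (h : ∀ q : F[X], Irreducible q → q.Monic → HasExchangePropertyOn u (primaryPart (u ^ 2) q)) :
    HasExchangeProperty u := by
  refine .of_iSupIndep (iSupIndep_primaryPart (u ^ 2)) (iSup_primaryPart fun x => ?_)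
    fun q => h q.1 q.2.1 q.2.2
  obtain ⟨f, hf, hx⟩ := hu.exists_aeval_eq_zero x
  obtain ⟨h, hh, hfh⟩ := exists_dvd_expand hf
  exact ⟨h, hh, by rw [← expand_aeval]; exact aeval_apply_eq_zero_of_dvd hfh hx⟩

/-! ### The easy implications -/

theorem HasExchangeProperty.isSumOfTwoSquareZero {u : Module.End F V} (h : HasExchangeProperty u) :
    IsSumOfTwoSquareZero u := by
  obtain ⟨A, B, hAB, hA, hB⟩ := h
  refine ⟨u * A.projection B hAB, u * B.projection A hAB.symm, ?_, ?_, ?_⟩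
  · ext x
    have h1 : u (A.projection B hAB x) ∈ B := hA ⟨_, Submodule.projection_apply_mem hAB x, rfl⟩
    simp [sq, Submodule.projection_apply_of_mem_right hAB h1]
  · ext x
    have h1 : u (B.projection A hAB.symm x) ∈ A :=
      hB ⟨_, Submodule.projection_apply_mem hAB.symm x, rfl⟩
    simp [sq, Submodule.projection_apply_of_mem_right hAB.symm h1]
  · ext x
    have hx : x ∈ A ⊔ B := hAB.sup_eq_top ▸ Submodule.mem_top
    obtain ⟨a, ha, b, hb, rfl⟩ := Submodule.mem_sup.1 hx
    simp [Submodule.projection_apply_of_mem_left _ ha, Submodule.projection_apply_of_mem_left _ hb,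
      Submodule.projection_apply_of_mem_right _ ha, Submodule.projection_apply_of_mem_right _ hb]

/-- The conjugating automorphism is the identity on one summand and `-1` on the other. -/
theorem HasExchangeProperty.isSimilar_neg {u : Module.End F V} (h : HasExchangeProperty u) :
    IsSimilar u (-u) := by
  obtain ⟨A, B, hAB, hA, hB⟩ := h
  let π : V →ₗ[F] V := A.projection B hAB - B.projection A hAB.symm
  have hπ : ∀ {a b}, a ∈ A → b ∈ B → π (a + b) = a - b := by
    intro a b ha hb
    simp [π, Submodule.projection_apply_of_mem_left _ ha,
      Submodule.projection_apply_of_mem_left _ hb, Submodule.projection_apply_of_mem_right _ ha,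
      Submodule.projection_apply_of_mem_right _ hb]
  have hdec : ∀ x, ∃ a ∈ A, ∃ b ∈ B, a + b = x := fun x =>
    Submodule.mem_sup.1 (hAB.sup_eq_top ▸ Submodule.mem_top)
  have hinv : Function.Involutive π := by
    intro x
    obtain ⟨a, ha, b, hb, rfl⟩ := hdec x
    rw [hπ ha hb, sub_eq_add_neg, hπ ha (neg_mem hb), sub_neg_eq_add]
  refine ⟨LinearEquiv.ofInvolutive π hinv, LinearMap.ext fun x => ?_⟩
  obtain ⟨a, ha, b, hb, rfl⟩ := hdec x
  change -u (a + b) = π (u (π (a + b)))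
  rw [hπ ha hb, map_sub, sub_eq_neg_add, hπ (neg_mem (hB ⟨b, hb, rfl⟩)) (hA ⟨a, ha, rfl⟩), map_add]
  abel

/-! ### Sums of two square-zero endomorphisms -/

theorem primaryPart_sq_X_le (u : Module.End F V) : primaryPart (u ^ 2) X ≤ primaryPart u X := by
  rintro x ⟨n, hn⟩
  refine ⟨2 * n, ?_⟩
  rwa [map_pow, aeval_X, pow_mul, ← aeval_X (R := F) (u ^ 2), ← map_pow]

/-- On a primary part of `u ^ 2` for a polynomial other than `X`, the endomorphism `u` is bijective,
and the kernels of the two square-zero endomorphisms provide the decomposition. -/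
theorem HasExchangePropertyOn.of_sum_of_isCoprime {u a b : Module.End F V} (ha : a ^ 2 = 0)
    (hb : b ^ 2 = 0) (hu : u = a + b) {q : F[X]} (hq : IsCoprime X q) :
    HasExchangePropertyOn u (primaryPart (u ^ 2) q) := by
  have hsq : u ^ 2 = a * b + b * a := by
    rw [hu, sq, add_mul, mul_add, mul_add, ← sq, ← sq, ha, hb]; abel
  rw [sq] at ha hb
  have hca : Commute (u ^ 2) a := by
    rw [hsq, commute_iff_eq, add_mul, mul_add, mul_assoc, mul_assoc, ha, ← mul_assoc a a, ha]
    simp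
  have hcb : Commute (u ^ 2) b := by
    rw [hsq, commute_iff_eq, add_mul, mul_add, mul_assoc, mul_assoc, hb, ← mul_assoc b b, hb]
    simp
  have haa : ∀ x, a (a x) = 0 := fun x => LinearMap.congr_fun ha x
  have hbb : ∀ x, b (b x) = 0 := fun x => LinearMap.congr_fun hb x
  have hux : ∀ x, u x = a x + b x := fun x => LinearMap.congr_fun hu x
  refine ⟨a.ker ⊓ primaryPart (u ^ 2) q, b.ker ⊓ primaryPart (u ^ 2) q, ?_, ?_, ?_, ?_⟩
  · rw [Submodule.disjoint_def]
    rintro x ⟨hxa, n, hn⟩ ⟨hxb, -⟩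
    refine eq_zero_of_isCoprime (w := u ^ 2) (hq.pow_right (n := n)) ?_ hn
    rw [aeval_X, sq, Module.End.mul_apply, hux x, LinearMap.mem_ker.1 hxa, LinearMap.mem_ker.1 hxb]
    simp
  · refine le_antisymm (sup_le inf_le_right inf_le_right) fun x hx => ?_
    obtain ⟨n, hn⟩ := id hx
    obtain ⟨c, d, hcd⟩ := hq.pow_right (n := n)
    have hx' : x = (u ^ 2) (aeval (u ^ 2) c x) := by
      have h1 : aeval (u ^ 2) (X * c + d * q ^ n) x = x := by
        rw [mul_comm X c, hcd, aeval_one, Module.End.one_apply]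
      rw [aeval_add, aeval_mul, aeval_mul, aeval_X, LinearMap.add_apply, Module.End.mul_apply,
        Module.End.mul_apply, hn, map_zero, add_zero] at h1
      exact h1.symm
    have hy : aeval (u ^ 2) c x ∈ primaryPart (u ^ 2) q :=
      apply_mem_primaryPart (commute_aeval (Commute.refl _) c).symm hx
    have hx'' : x = a (b (aeval (u ^ 2) c x)) + b (a (aeval (u ^ 2) c x)) :=
      hx'.trans (LinearMap.congr_fun hsq _)
    rw [hx'']
    exact Submodule.add_mem_sup
      ⟨haa _, apply_mem_primaryPart hca (apply_mem_primaryPart hcb hy)⟩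
      ⟨hbb _, apply_mem_primaryPart hcb (apply_mem_primaryPart hca hy)⟩
  · rintro _ ⟨x, ⟨hxa, hx⟩, rfl⟩
    rw [hux, LinearMap.mem_ker.1 hxa, zero_add]
    exact ⟨hbb x, apply_mem_primaryPart hcb hx⟩
  · rintro _ ⟨x, ⟨hxb, hx⟩, rfl⟩
    rw [hux, LinearMap.mem_ker.1 hxb, add_zero]
    exact ⟨haa x, apply_mem_primaryPart hca hx⟩

theorem IsSumOfTwoSquareZero.hasExchangeProperty (hV : Module.rank F V ≤ Cardinal.aleph0)
    {u : Module.End F V} (hu : IsLocallyFinite u) (h : IsSumOfTwoSquareZero u) :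
    HasExchangeProperty u := by
  obtain ⟨a, b, ha, hb, hab⟩ := h
  refine .of_primaryPart_sq hu fun q hq _ => ?_
  by_cases hX : X ∣ q
  · have hqX : primaryPart (u ^ 2) q ≤ primaryPart (u ^ 2) X :=
      primaryPart_mono (irreducible_X.associated_of_dvd hq hX).dvd'
    exact .of_primary hV (fun x => apply_mem_primaryPart ((Commute.refl u).pow_left 2))
      irreducible_X (.inr X_mem_oddPolynomials) (hqX.trans (primaryPart_sq_X_le u))
  · exact .of_sum_of_isCoprime ha hb hab (irreducible_X.coprime_iff_not_dvd.2 hX)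

/-! ### Reflection of polynomials -/

theorem coeff_comp_neg_X (f : F[X]) (n : ℕ) : (f.comp (-X)).coeff n = f.coeff n * (-1) ^ n := by
  have h : (-X : F[X]) = C (-1) * X := by simp
  rw [h, comp_C_mul_X_coeff]

theorem mem_evenPolynomials_of_comp_neg_X_eq (h2 : (2 : F) ≠ 0) {f : F[X]}
    (hf : f.comp (-X) = f) : f ∈ evenPolynomials F := by
  intro n hn
  have h := coeff_comp_neg_X f n
  rw [hf, hn.neg_one_pow] at h
  have h' : 2 * f.coeff n = 0 := by linear_combination h
  exact (mul_eq_zero.1 h').resolve_left h2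

theorem mem_oddPolynomials_of_comp_neg_X_eq (h2 : (2 : F) ≠ 0) {f : F[X]}
    (hf : f.comp (-X) = -f) : f ∈ oddPolynomials F := by
  intro n hn
  have h := coeff_comp_neg_X f n
  rw [hf, hn.neg_one_pow, coeff_neg] at h
  have h' : 2 * f.coeff n = 0 := by linear_combination -h
  exact (mul_eq_zero.1 h').resolve_left h2

theorem exists_eq_expand_of_comp_neg_X_eq (h2 : (2 : F) ≠ 0) {f : F[X]} (hf : f.comp (-X) = f) :
    ∃ h : F[X], f = expand F 2 h := by
  refine ⟨contract 2 f, ?_⟩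
  ext n
  rw [coeff_expand two_pos]
  split_ifs with hn
  · rw [coeff_contract two_ne_zero, Nat.div_mul_cancel hn]
  · exact mem_evenPolynomials_of_comp_neg_X_eq h2 hf n
      (by rwa [← Nat.not_even_iff_odd, even_iff_two_dvd])

theorem expand_two_comp_neg_X (h : F[X]) : (expand F 2 h).comp (-X) = expand F 2 h := by
  ext n
  rw [coeff_comp_neg_X, coeff_expand two_pos]
  split_ifs with hn
  · rw [(even_iff_two_dvd.2 hn).neg_one_pow, mul_one]
  · rw [zero_mul]

/-- An irreducible polynomial dividing its reflection is homogeneous. -/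
theorem mem_even_or_odd_of_dvd_comp_neg_X (h2 : (2 : F) ≠ 0) {g : F[X]} (hg : Irreducible g)
    (h : g ∣ g.comp (-X)) : g ∈ evenPolynomials F ∨ g ∈ oddPolynomials F := by
  obtain ⟨c, hc⟩ := h
  have hdeg := congrArg natDegree hc
  have hc0 : c ≠ 0 := by
    rintro rfl
    rw [mul_zero, comp_neg_X_eq_zero_iff] at hc
    exact hg.ne_zero hc
  rw [natDegree_mul hg.ne_zero hc0, natDegree_comp, natDegree_neg, natDegree_X, mul_one,
    left_eq_add] at hdeg
  obtain ⟨a, rfl⟩ := natDegree_eq_zero.1 hdeg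
  have hlead := congrArg leadingCoeff hc
  rw [comp_neg_X_leadingCoeff_eq, leadingCoeff_mul, leadingCoeff_C, mul_comm] at hlead
  have ha : a = (-1) ^ g.natDegree :=
    (mul_left_cancel₀ (leadingCoeff_ne_zero.2 hg.ne_zero) hlead).symm
  rcases neg_one_pow_eq_or F g.natDegree with h1 | h1
  · rw [ha, h1, C_1, mul_one] at hc
    exact .inl (mem_evenPolynomials_of_comp_neg_X_eq h2 hc)
  · rw [ha, h1, C_neg, C_1, mul_neg, mul_one] at hc
    exact .inr (mem_oddPolynomials_of_comp_neg_X_eq h2 hc)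

theorem dvd_of_expand_dvd_expand (h2 : (2 : F) ≠ 0) {f g : F[X]} (hf : f ≠ 0)
    (h : expand F 2 f ∣ expand F 2 g) : f ∣ g := by
  obtain ⟨c, hc⟩ := h
  have hcc : expand F 2 f * c.comp (-X) = expand F 2 f * c := by
    rw [← expand_two_comp_neg_X f, ← mul_comp, expand_two_comp_neg_X f, ← hc,
      expand_two_comp_neg_X g]
  obtain ⟨d, rfl⟩ := exists_eq_expand_of_comp_neg_X_eq h2
    (mul_left_cancel₀ ((expand_ne_zero two_pos).2 hf) hcc)
  refine ⟨d, expand_injective two_pos ?_⟩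
  rw [hc, map_mul]

/-- If `q` is irreducible and `g` is an irreducible factor of `q(X²)`, then `q(X²)` divides
`g(X) g(-X)`: this product is of the form `h(X²)`, and `h` divides `q²`. -/
theorem exists_irreducible_dvd_expand (h2 : (2 : F) ≠ 0) {q : F[X]} (hq : Irreducible q) :
    ∃ g : F[X], Irreducible g ∧ g ∣ expand F 2 q ∧ expand F 2 q ∣ g * g.comp (-X) := by
  have hnu : ¬ IsUnit (expand F 2 q) := by
    intro hu
    have h1 := natDegree_eq_zero_of_isUnit hu
    rw [natDegree_expand] at h1
    have := hq.natDegree_pos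
    omega
  have hq0 : expand F 2 q ≠ 0 := (expand_ne_zero two_pos).2 hq.ne_zero
  obtain ⟨g, hg, hgq⟩ := WfDvdMonoid.exists_irreducible_factor hnu hq0
  refine ⟨g, hg, hgq, ?_⟩
  have hgq' : g.comp (-X) ∣ expand F 2 q := by
    rw [← dvd_comp_neg_X_iff, expand_two_comp_neg_X]; exact hgq
  obtain ⟨h, hh⟩ := exists_eq_expand_of_comp_neg_X_eq h2 (f := g * g.comp (-X))
    (by rw [mul_comp, comp_neg_X_comp_neg_X, mul_comm])
  have hh0 : h ≠ 0 := by
    rintro rfl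
    rw [map_zero] at hh
    exact mul_ne_zero hg.ne_zero (mt comp_neg_X_eq_zero_iff.1 hg.ne_zero) hh
  have hhq : h ∣ q ^ 2 := by
    refine dvd_of_expand_dvd_expand h2 hh0 ?_
    rw [← hh, map_pow, sq]
    exact mul_dvd_mul hgq hgq'
  obtain ⟨i, -, hi⟩ := (_root_.dvd_prime_pow hq.prime 2).1 hhq
  have hi0 : i ≠ 0 := by
    rintro rfl
    rw [pow_zero, associated_one_iff_isUnit] at hi
    have hu : IsUnit (g * g.comp (-X)) := hh ▸ hi.map (expand F 2)
    exact hg.not_isUnit (isUnit_of_mul_isUnit_left hu)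
  rw [hh]
  exact _root_.map_dvd (expand F 2) ((dvd_pow_self q hi0).trans hi.dvd')

/-! ### Endomorphisms similar to their opposite -/

theorem aeval_comp_neg_X_apply {u φ : Module.End F V} (hφ : ∀ x, φ (u x) = -u (φ x)) (f : F[X])
    (x : V) : φ (aeval u f x) = aeval u (f.comp (-X)) (φ x) := by
  induction f using Polynomial.induction_on' with
  | add f g hf hg => simp [hf, hg]
  | monomial n a =>
    have h : ∀ x, φ ((u ^ n) x) = ((-u) ^ n) (φ x) := by
      induction n with
      | zero => simp
      | succ n ih =>
        intro x
        rw [pow_succ, pow_succ, Module.End.mul_apply, Module.End.mul_apply, ih, hφ]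
        rfl
    rw [monomial_comp, aeval_mul, aeval_C, map_pow, map_neg, aeval_X, aeval_monomial,
      Module.End.mul_apply, Module.End.mul_apply, ← h, Module.algebraMap_end_apply,
      Module.algebraMap_end_apply, map_smul]

theorem map_mem_primaryPart_comp_neg_X {u φ : Module.End F V} (hφ : ∀ x, φ (u x) = -u (φ x))
    {g : F[X]} {x : V} (hx : x ∈ primaryPart u g) : φ x ∈ primaryPart u (g.comp (-X)) := by
  obtain ⟨n, hn⟩ := hx
  exact ⟨n, by rw [← pow_comp, ← aeval_comp_neg_X_apply hφ, hn, map_zero]⟩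

/-- If `φ` conjugates `u` to `-u`, it exchanges the primary parts for `g(X)` and `g(-X)`; if these
polynomials are coprime, then the vectors `x + φ x` and `x - φ x` form the decomposition. -/
theorem HasExchangePropertyOn.of_isCoprime_comp_neg_X (h2 : (2 : F) ≠ 0) {u : Module.End F V}
    {φ : V ≃ₗ[F] V} (hφ : ∀ x, φ (u x) = -u (φ x)) {g : F[X]} (hg : IsCoprime g (g.comp (-X))) :
    HasExchangePropertyOn u (primaryPart u g ⊔ primaryPart u (g.comp (-X))) := by
  have hφ' : ∀ x, φ.symm (u x) = -u (φ.symm x) := by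
    intro x
    rw [LinearEquiv.symm_apply_eq, map_neg, hφ, neg_neg, LinearEquiv.apply_symm_apply]
  have hmem : ∀ {x}, x ∈ primaryPart u g → φ x ∈ primaryPart u (g.comp (-X)) := fun hx =>
    map_mem_primaryPart_comp_neg_X (φ := φ.toLinearMap) hφ hx
  have hmem' : ∀ {x}, x ∈ primaryPart u (g.comp (-X)) → φ.symm x ∈ primaryPart u g := fun hx => by
    have := map_mem_primaryPart_comp_neg_X (φ := φ.symm.toLinearMap) hφ' hx
    rwa [comp_neg_X_comp_neg_X] at this
  have hu : ∀ {x}, x ∈ primaryPart u g → u x ∈ primaryPart u g :=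
    apply_mem_primaryPart (Commute.refl u)
  refine ⟨(primaryPart u g).map (1 + φ.toLinearMap), (primaryPart u g).map (1 - φ.toLinearMap),
    ?_, ?_, ?_, ?_⟩
  · rw [Submodule.disjoint_def]
    rintro _ ⟨x, hx, rfl⟩ ⟨y, hy, hxy⟩
    replace hxy : y - φ y = x + φ x := hxy
    have h1 : y - x = φ (x + y) := by
      rw [map_add, sub_eq_iff_eq_add]
      exact (sub_eq_iff_eq_add.1 hxy).trans (by abel)
    -- This vector lies in both primary parts.
    have h3 : y - x = 0 := by
      obtain ⟨n, hn⟩ := sub_mem hy hx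
      obtain ⟨m, hm⟩ := h1 ▸ hmem (add_mem hx hy)
      exact eq_zero_of_isCoprime (hg.pow (m := n) (n := m)) hn hm
    rw [h3, eq_comm, map_eq_zero_iff φ φ.injective] at h1
    have hx0 : x = 0 := by
      rw [sub_eq_zero.1 h3, ← two_smul F] at h1
      exact (smul_eq_zero.1 h1).resolve_left h2
    rw [hx0, map_zero]
  · refine le_antisymm (sup_le ?_ ?_) (sup_le ?_ ?_)
    · rintro _ ⟨x, hx, rfl⟩
      exact Submodule.add_mem_sup hx (hmem hx)
    · rintro _ ⟨x, hx, rfl⟩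
      rw [LinearMap.sub_apply, sub_eq_add_neg]
      exact Submodule.add_mem_sup hx (neg_mem (hmem hx))
    · intro x hx
      have h1 : x = (1 + φ.toLinearMap) ((2 : F)⁻¹ • x) + (1 - φ.toLinearMap) ((2 : F)⁻¹ • x) := by
        rw [← LinearMap.add_apply, add_add_sub_cancel, LinearMap.add_apply, Module.End.one_apply,
          ← two_smul F, smul_inv_smul₀ h2]
      rw [h1]
      exact Submodule.add_mem_sup ⟨_, Submodule.smul_mem _ _ hx, rfl⟩
        ⟨_, Submodule.smul_mem _ _ hx, rfl⟩
    · intro y hy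
      obtain ⟨x, rfl⟩ := φ.surjective y
      have hx := hmem' hy
      rw [LinearEquiv.symm_apply_apply] at hx
      have h1 : φ x =
          (1 + φ.toLinearMap) ((2 : F)⁻¹ • x) + (1 - φ.toLinearMap) (-((2 : F)⁻¹ • x)) := by
        rw [map_neg, ← sub_eq_add_neg, ← LinearMap.sub_apply, add_sub_sub_cancel,
          LinearMap.add_apply, LinearEquiv.coe_coe, ← two_smul F, map_smul, smul_inv_smul₀ h2]
      rw [h1]
      exact Submodule.add_mem_sup ⟨_, Submodule.smul_mem _ _ hx, rfl⟩
        ⟨_, neg_mem (Submodule.smul_mem _ _ hx), rfl⟩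
  · rintro _ ⟨_, ⟨x, hx, rfl⟩, rfl⟩
    exact ⟨u x, hu hx, by simp [hφ]⟩
  · rintro _ ⟨_, ⟨x, hx, rfl⟩, rfl⟩
    exact ⟨u x, hu hx, by simp [hφ, sub_eq_add_neg]⟩

theorem IsSimilar.hasExchangeProperty (h2 : (2 : F) ≠ 0) (hV : Module.rank F V ≤ Cardinal.aleph0)
    {u : Module.End F V} (hu : IsLocallyFinite u) (h : IsSimilar u (-u)) :
    HasExchangeProperty u := by
  obtain ⟨φ, hφ⟩ := h
  have hφu : ∀ x, φ (u x) = -u (φ x) := by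
    intro x
    have h1 := LinearMap.congr_fun hφ (φ x)
    simpa using h1.symm
  refine .of_primaryPart_sq hu fun q hq _ => ?_
  obtain ⟨g, hg, hgq, hqg⟩ := exists_irreducible_dvd_expand h2 hq
  have hexp : primaryPart (u ^ 2) q = primaryPart u (expand F 2 q) := by
    ext x
    simp only [mem_primaryPart, ← map_pow, expand_aeval]
  by_cases hgg : g ∣ g.comp (-X)
  · refine .of_primary hV (fun x => apply_mem_primaryPart ((Commute.refl u).pow_left 2)) hg
      (mem_even_or_odd_of_dvd_comp_neg_X h2 hg hgg) ?_
    -- As `g(-X)` divides `g`, the polynomial `q(X²)` divides `g²`.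
    rw [hexp]
    rintro x ⟨n, hn⟩
    have hgg' : g.comp (-X) ∣ g := (dvd_comp_neg_X_iff g g).1 hgg
    refine ⟨2 * n, aeval_apply_eq_zero_of_dvd ?_ hn⟩
    rw [pow_mul, sq]
    exact pow_dvd_pow_of_dvd (hqg.trans (mul_dvd_mul_left g hgg')) n
  · have hcop : IsCoprime g (g.comp (-X)) := hg.coprime_iff_not_dvd.2 hgg
    have hgq' : g.comp (-X) ∣ expand F 2 q := by
      rw [← dvd_comp_neg_X_iff, expand_two_comp_neg_X]; exact hgq
    have hsup : primaryPart (u ^ 2) q = primaryPart u g ⊔ primaryPart u (g.comp (-X)) := by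
      rw [hexp]
      refine le_antisymm ?_ (sup_le (primaryPart_mono hgq) (primaryPart_mono hgq'))
      rintro x ⟨n, hn⟩
      have hn' := aeval_apply_eq_zero_of_dvd (pow_dvd_pow_of_dvd hqg n) hn
      rw [mul_pow] at hn'
      obtain ⟨y, z, hy, hz, rfl⟩ := exists_add_of_isCoprime (hcop.pow (m := n) (n := n)) hn'
      exact Submodule.add_mem_sup ⟨n, hy⟩ ⟨n, hz⟩
    rw [hsup]
    exact .of_isCoprime_comp_neg_X h2 hφu hcop

end TwoSquareZero

theorem mainTheorem1 {F V : Type*} [Field F] [AddCommGroup V] [Module F V]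
    (hV : Module.rank F V ≤ Cardinal.aleph0)
    (u : Module.End F V) (hu : TwoSquareZero.IsLocallyFinite u) :
    (TwoSquareZero.IsSumOfTwoSquareZero u ↔ TwoSquareZero.HasExchangeProperty u) ∧
      (ringChar F ≠ 2 →
        (TwoSquareZero.HasExchangeProperty u ↔ TwoSquareZero.IsSimilar u (-u))) :=
  ⟨⟨TwoSquareZero.IsSumOfTwoSquareZero.hasExchangeProperty hV hu,
    TwoSquareZero.HasExchangeProperty.isSumOfTwoSquareZero⟩,
    fun h2 => ⟨TwoSquareZero.HasExchangeProperty.isSimilar_neg,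
      TwoSquareZero.IsSimilar.hasExchangeProperty (Ring.two_ne_zero h2) hV hu⟩⟩
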